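/- For $0<\beta\le 1$ let $E_\beta(z)=\sum_{n\ge 0} \frac{z^n}{\Gamma(\beta n+1)}$, $z\in\mathbb{C}$, be the Mittag-Leffler function. For $\lambda>0$ let $$\pi_{\lambda,\beta}=\sum_{k=0}^\infty \frac{\lambda^k}{k!}E_\beta^{(k)}(-\lambda)\,\delta_k$$ be the fractional Poisson measure on $\mathbb{N}_0$, and for $r\ge 0$ let $\pi_r=\sum_{k\ge 0}\frac{r^k}{k!}e^{-r}\delta_k$ be the Poisson measure with rate $r$ ($\pi_0=\delta_0$). For $0<\beta<1$ let $\nu_\beta$ be the measure on $[0,\infty)$ with Lebesgue density the M-Wright function $$M_\beta(\tau)=\sum_{n=0}^\infty\frac{(-\tau)^n}{n!\,\Gamma(-\beta n+1-\beta)},$$ where $1/\Gamma$ is taken to be $0$ at the poles of $\Gamma$, and let $\nu_1=\delta_1$. Let $0<\beta\le 1$. Then $M_\beta\ge 0$ on $[0,\infty)$ if $\beta<1$; $\nu_\beta$ is a probability measure; for every $z\in\mathbb{C}$ the function $\tau\mapsto e^{-z\tau}$ is $\nu_\beta$-integrable and $$\int_0^\infty e^{-z\tau}\,d\nu_\beta(\tau)=E_\beta(-z).$$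 Moreover, for every $\lambda>0$, the weights $\frac{\lambda^k}{k!}E_\beta^{(k)}(-\lambda)$, $k\in\mathbb{N}_0$, are non-negative, and the fractional Poisson measure is a mixture of Poisson measures: $$\pi_{\lambda,\beta}=\int_0^\infty \pi_{\lambda\tau}\,d\nu_\beta(\tau).$$ -/

import Mathlib

open MeasureTheory ProbabilityTheory
open scoped Nat NNReal ENNReal

noncomputable section

/-- The Mittag-Leffler function `E_β(z) = ∑ₙ zⁿ / Γ(β n + 1)` of a complex variable. -/
def mittagLeffler (β : ℝ) (z : ℂ) : ℂ :=
  ∑' n : ℕ, z ^ n / ((Real.Gamma (β * n + 1) : ℝ) : ℂ)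

/-- The (real) weight `(λᵏ / k!) E_β^{(k)}(-λ)` of the fractional Poisson measure at `k`.
The derivatives of `E_β` are real on the real axis. -/
def fractionalPoissonWeight (lam β : ℝ) (k : ℕ) : ℝ :=
  lam ^ k / (k ! : ℝ) * (iteratedDeriv k (mittagLeffler β) (-(lam : ℂ))).re

/-- The fractional Poisson measure `π_{λ,β} = ∑ₖ (λᵏ / k!) E_β^{(k)}(-λ) δₖ` on `ℕ`. -/
def fractionalPoissonMeasure (lam β : ℝ) : Measure ℕ :=
  Measure.sum fun k : ℕ =>
    ENNReal.ofReal (fractionalPoissonWeight lam β k) • Measure.dirac k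

/-- The M-Wright function `M_β(τ) = ∑ₙ (-τ)ⁿ / (n! Γ(-β n + 1 - β))`, for `0 < β < 1`.
The reciprocal `1/Γ` vanishes at the poles `0, -1, -2, …` of `Γ`; since `Real.Gamma` is `0`
there and `0⁻¹ = 0`, the inverse below is the entire function `1/Γ`. -/
def mWright (β τ : ℝ) : ℝ :=
  ∑' n : ℕ, (-τ) ^ n / (n ! : ℝ) * (Real.Gamma (-β * n + (1 - β)))⁻¹

open Classical in
/-- The measure `ν_β` on `[0, ∞)` (as a measure on `ℝ` carried by `[0, ∞)`): the measure with
Lebesgue density `M_β` for `0 < β < 1`, and the Dirac measure at `1`, to which it degenerates,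
for `β = 1`. -/
def mWrightMeasure (β : ℝ) : Measure ℝ :=
  if β = 1 then Measure.dirac 1
  else (volume.restrict (Set.Ici (0 : ℝ))).withDensity fun τ => ENNReal.ofReal (mWright β τ)

end

/-! Everything reduces to the moments `∫ τ ^ k dν_β = k! / Γ(β k + 1)`. Summing them against `z ^ k
/ k!` gives `∫ exp (z τ) dν_β = E_β(z)`, so `E_β` is the moment generating function of `ν_β`. It is
finite everywhere, so it may be differentiated under the integral, and the weight at `k` becomes the
`ν_β`-average of the Poisson weight with rate `λ τ`. For `β < 1`, the moments and the positivity of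
`M_β` come from a discrete model: a renewal process whose waiting times have generating function `1
- (1 - X) ^ β` (Sibuya law). The probability of `j` renewals up to time `n` is non-negative because
it is a coefficient of a product of series with non-negative coefficients. Expanding that product
binomially and applying Euler's limit for `Γ` gives a local limit theorem: at `j ≈ τ n ^ β`, the
probability times `n ^ β` tends to `M_β(τ)` (`tendsto_renewalDensity`). The rising factorial moments
of the model are explicit (`sum_choose_mul_renewalWeight`) and converge, after rescaling, to `k! /
Γ(β k + 1)`; `lintegral_pow_mul_mWright` shows that no mass escapes in the limit. -/

open Filter Topology

/-! ### Binomial series and the renewal weights -/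

/-- The `n`-th Taylor coefficient `x (x + 1) ⋯ (x + n - 1) / n!` of `(1 - X) ^ (-x)`. -/
noncomputable def risingCoeff (x : ℝ) (n : ℕ) : ℝ :=
  (∏ m ∈ Finset.range n, (x + m)) / n !

/-- The power series `(1 - X) ^ (-x)`. -/
noncomputable def negPowSeries (x : ℝ) : PowerSeries ℝ := PowerSeries.mk (risingCoeff x)

theorem coeff_negPowSeries (x : ℝ) (n : ℕ) :
    PowerSeries.coeff n (negPowSeries x) = risingCoeff x n := by
  simp [negPowSeries]

theorem negPowSeries_eq_rescale (x : ℝ) :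
    negPowSeries x = PowerSeries.rescale (-1) (PowerSeries.binomialSeries ℝ (-x)) := by
  ext n
  have h : ∏ m ∈ Finset.range n, (x + m) = (-1) ^ n * ∏ m ∈ Finset.range n, (-x - m) := by
    rw [← Finset.card_range n, ← Finset.prod_const, Finset.card_range, ← Finset.prod_mul_distrib]
    exact Finset.prod_congr rfl fun m _ => by ring
  rw [coeff_negPowSeries, PowerSeries.coeff_rescale, PowerSeries.binomialSeries_coeff,
    Ring.choose_eq_smul, ← Polynomial.aeval_eq_smeval, Polynomial.aeval_def,
    ← Polynomial.eval_map, descPochhammer_map, descPochhammer_eval_eq_prod_range, risingCoeff, h]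
  simp only [smul_eq_mul, mul_one]
  ring

theorem negPowSeries_add (x y : ℝ) :
    negPowSeries (x + y) = negPowSeries x * negPowSeries y := by
  simp only [negPowSeries_eq_rescale, neg_add, PowerSeries.binomialSeries_add, map_mul]

theorem negPowSeries_zero : negPowSeries 0 = 1 := by
  rw [negPowSeries_eq_rescale, neg_zero, PowerSeries.binomialSeries_zero, map_one]

theorem negPowSeries_pow (x : ℝ) (i : ℕ) : negPowSeries x ^ i = negPowSeries (i * x) := by
  induction i with
  | zero => simp [negPowSeries_zero]
  | succ i ih => rw [pow_succ, ih, ← negPowSeries_add]; congr 1; push_cast; ring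

theorem risingCoeff_nonneg {x : ℝ} (hx : 0 ≤ x) (n : ℕ) : 0 ≤ risingCoeff x n :=
  div_nonneg (Finset.prod_nonneg fun m _ => by positivity) (by positivity)

/-- The coefficient of `X ^ n` in `(1 - (1 - X) ^ β) ^ j * (1 - X) ^ (β - 1)`: the probability that
a renewal process with Sibuya-distributed waiting times has `j` renewals up to time `n`. -/
noncomputable def renewalWeight (β : ℝ) (n j : ℕ) : ℝ :=
  PowerSeries.coeff n ((1 - negPowSeries (-β)) ^ j * negPowSeries (1 - β))

theorem PowerSeries.coeff_mul_nonneg {p q : PowerSeries ℝ} (hp : ∀ n, 0 ≤ PowerSeries.coeff n p)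
    (hq : ∀ n, 0 ≤ PowerSeries.coeff n q) (n : ℕ) : 0 ≤ PowerSeries.coeff n (p * q) := by
  rw [PowerSeries.coeff_mul]
  exact Finset.sum_nonneg fun i _ => mul_nonneg (hp _) (hq _)

theorem PowerSeries.coeff_pow_nonneg {p : PowerSeries ℝ} (hp : ∀ n, 0 ≤ PowerSeries.coeff n p)
    (j n : ℕ) : 0 ≤ PowerSeries.coeff n (p ^ j) := by
  induction j generalizing n with
  | zero => rw [pow_zero, PowerSeries.coeff_one]; split_ifs <;> norm_num
  | succ j ih => rw [pow_succ]; exact PowerSeries.coeff_mul_nonneg ih hp n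

/-- In `(-β)(1 - β)(2 - β)⋯` only the first factor is negative, and the subtraction reverses its
sign. -/
theorem coeff_one_sub_negPowSeries_nonneg {β : ℝ} (h0 : 0 ≤ β) (h1 : β ≤ 1) (n : ℕ) :
    0 ≤ PowerSeries.coeff n (1 - negPowSeries (-β)) := by
  rw [map_sub, coeff_negPowSeries, PowerSeries.coeff_one]
  cases n with
  | zero => simp [risingCoeff]
  | succ n =>
    have h : 0 ≤ ∏ m ∈ Finset.range n, (-β + (m + 1 : ℕ)) :=
      Finset.prod_nonneg fun m _ => by push_cast; linarith [m.cast_nonneg (α := ℝ)]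
    rw [if_neg n.succ_ne_zero, risingCoeff, Finset.prod_range_succ', zero_sub, ← neg_div]
    refine div_nonneg ?_ (by positivity)
    push_cast at h ⊢
    nlinarith [mul_nonneg h h0]

theorem renewalWeight_nonneg {β : ℝ} (h0 : 0 ≤ β) (h1 : β ≤ 1) (n j : ℕ) :
    0 ≤ renewalWeight β n j :=
  PowerSeries.coeff_mul_nonneg
    (PowerSeries.coeff_pow_nonneg (coeff_one_sub_negPowSeries_nonneg h0 h1) j)
    (fun n => by rw [coeff_negPowSeries]; exact risingCoeff_nonneg (by linarith) n) n

theorem X_dvd_one_sub_negPowSeries (x : ℝ) : PowerSeries.X ∣ 1 - negPowSeries x := by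
  rw [PowerSeries.X_dvd_iff, ← PowerSeries.coeff_zero_eq_constantCoeff_apply, map_sub,
    coeff_negPowSeries]
  simp [risingCoeff]

theorem renewalWeight_eq_zero {β : ℝ} {n j : ℕ} (h : n < j) : renewalWeight β n j = 0 := by
  have : PowerSeries.X ^ j ∣ (1 - negPowSeries (-β)) ^ j * negPowSeries (1 - β) :=
    (pow_dvd_pow_of_dvd (X_dvd_one_sub_negPowSeries _) j).mul_right _
  exact PowerSeries.X_pow_dvd_iff.1 this n h

/-- Binomial theorem in `(1 - X) ^ β`: the `i`-th power times `(1 - X) ^ (β - 1)` is again a pure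
power, of exponent `β (i + 1) - 1`. -/
theorem renewalWeight_eq_sum (β : ℝ) (n j : ℕ) :
    renewalWeight β n j =
      ∑ i ∈ Finset.range (j + 1), (j.choose i : ℝ) * (-1) ^ i * risingCoeff (1 - β * (i + 1)) n := by
  rw [renewalWeight, sub_eq_neg_add, add_pow, Finset.sum_mul, map_sum]
  refine Finset.sum_congr rfl fun i _ => ?_
  have : (-negPowSeries (-β)) ^ i * 1 ^ (j - i) * (j.choose i : PowerSeries ℝ) *
      negPowSeries (1 - β) =
      PowerSeries.C ((j.choose i : ℝ) * (-1) ^ i) * negPowSeries (1 - β * (i + 1)) := by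
    rw [neg_pow, negPowSeries_pow, show 1 - β * ((i : ℝ) + 1) = i * -β + (1 - β) by ring,
      negPowSeries_add]
    simp only [one_pow, map_mul, map_natCast, map_pow, map_neg, map_one]
    ring
  rw [this, PowerSeries.coeff_C_mul, coeff_negPowSeries]

/-! ### Rising factorial moments of the renewal weights -/

theorem one_sub_mul_sum_choose_mul_pow {R : Type*} [CommRing R] (P : R) (k N : ℕ) :
    (1 - P) * ∑ j ∈ Finset.range N, ((j + (k + 1)).choose (k + 1) : R) * P ^ j =
      ∑ j ∈ Finset.range N, ((j + k).choose k : R) * P ^ j - ((N + k).choose (k + 1) : R) * P ^ N := by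
  induction N with
  | zero => simp
  | succ N ih =>
    rw [Finset.sum_range_succ, Finset.sum_range_succ, mul_add, ih,
      show N + 1 + k = N + k + 1 by ring, show N + (k + 1) = N + k + 1 by ring,
      Nat.choose_succ_succ (N + k) k]
    push_cast
    ring

/-- Truncation of `∑ (j + k choose k) P ^ j = (1 - P) ^ (-(k + 1))`, with an error divisible by `P ^
N`, so that no convergence is involved. -/
theorem exists_one_sub_pow_mul_sum_choose {R : Type*} [CommRing R] (P : R) (k N : ℕ) :
    ∃ r, (1 - P) ^ (k + 1) * ∑ j ∈ Finset.range N, ((j + k).choose k : R) * P ^ j =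
      1 - P ^ N * r := by
  induction k with
  | zero => exact ⟨1, by simpa using mul_neg_geom_sum P N⟩
  | succ k ih =>
    obtain ⟨r, hr⟩ := ih
    refine ⟨r + (1 - P) ^ (k + 1) * ((N + k).choose (k + 1) : R), ?_⟩
    rw [pow_succ, mul_assoc, one_sub_mul_sum_choose_mul_pow, mul_sub, hr]
    ring

/-- With `1 - P = (1 - X) ^ β`, the negative binomial series times `(1 - X) ^ (β - 1)` is `(1 - X) ^
(-(β k + 1))`. The error is divisible by `X ^ (n + 1)` and does not reach degree `n`. -/
theorem sum_choose_mul_renewalWeight (β : ℝ) (n k : ℕ) :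
    ∑ j ∈ Finset.range (n + 1), ((j + k).choose k : ℝ) * renewalWeight β n j =
      risingCoeff (β * k + 1) n := by
  set P := 1 - negPowSeries (-β) with hP
  obtain ⟨r, hr⟩ := exists_one_sub_pow_mul_sum_choose P k (n + 1)
  have hQ : (1 - P) ^ (k + 1) * negPowSeries (β * (k + 1)) = 1 := by
    rw [hP, sub_sub_cancel, negPowSeries_pow, ← negPowSeries_add, ← negPowSeries_zero]
    congr 1; push_cast; ring
  have key : (∑ j ∈ Finset.range (n + 1), ((j + k).choose k : PowerSeries ℝ) * P ^ j) *
      negPowSeries (1 - β) =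
      negPowSeries (β * k + 1) - P ^ (n + 1) * (r * negPowSeries (β * k + 1)) := by
    rw [show β * k + 1 = β * (k + 1) + (1 - β) by ring, negPowSeries_add]
    linear_combination (negPowSeries (β * (k + 1)) * negPowSeries (1 - β)) * hr -
      (∑ j ∈ Finset.range (n + 1), ((j + k).choose k : PowerSeries ℝ) * P ^ j) *
      negPowSeries (1 - β) * hQ
  have hzero : PowerSeries.coeff n (P ^ (n + 1) * (r * negPowSeries (β * k + 1))) = 0 :=
    PowerSeries.X_pow_dvd_iff.1
      ((pow_dvd_pow_of_dvd (X_dvd_one_sub_negPowSeries (-β)) (n + 1)).mul_right _) n n.lt_succ_self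
  have := congrArg (PowerSeries.coeff n) key
  rw [map_sub, hzero, sub_zero, coeff_negPowSeries, Finset.sum_mul, map_sum] at this
  rw [← this]
  refine Finset.sum_congr rfl fun j _ => ?_
  rw [mul_assoc, ← map_natCast (PowerSeries.C (R := ℝ)), PowerSeries.coeff_C_mul, renewalWeight]

/-! ### Gamma function estimates and asymptotics -/

/-- By convexity, the slope of `log Γ` on `[x, x + a]` is at least its slope on `[x - 1, x]`, which
is `log (x - 1)`. -/
theorem Real.Gamma_mul_rpow_le_Gamma_add {x a : ℝ} (hx : 1 < x) (ha : 0 < a) :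
    Real.Gamma x * (x - 1) ^ a ≤ Real.Gamma (x + a) := by
  have hx1 : 0 < x - 1 := by linarith
  have hG := Real.Gamma_pos_of_pos (show 0 < x by linarith)
  have hG1 := Real.Gamma_pos_of_pos hx1
  have hGa := Real.Gamma_pos_of_pos (show 0 < x + a by linarith)
  have h := Real.convexOn_log_Gamma.slope_mono_adjacent (x := x - 1) (y := x) (z := x + a)
    hx1 (show 0 < x + a by linarith) (by linarith) (by linarith)
  have hrec : Real.Gamma x = (x - 1) * Real.Gamma (x - 1) := by
    rw [← Real.Gamma_add_one hx1.ne', sub_add_cancel]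
  simp only [Function.comp_apply, sub_sub_cancel, div_one, add_sub_cancel_left] at h
  rw [le_div_iff₀ ha, hrec, Real.log_mul hx1.ne' hG1.ne'] at h
  rw [← Real.log_le_log_iff (by positivity) hGa, Real.log_mul hG.ne' (by positivity),
    Real.log_rpow hx1]
  rw [hrec, Real.log_mul hx1.ne' hG1.ne']
  linarith

theorem Real.Gamma_add_le_Gamma_mul_rpow {y b : ℝ} (hy : 0 < y) (hb0 : 0 < b) (hb1 : b < 1) :
    Real.Gamma (y + b) ≤ Real.Gamma y * y ^ b := by
  have hG := Real.Gamma_pos_of_pos hy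
  have h := Real.Gamma_mul_add_mul_le_rpow_Gamma_mul_rpow_Gamma hy (show 0 < y + 1 by linarith)
    (show 0 < 1 - b by linarith) hb0 (by ring)
  rw [show (1 - b) * y + b * (y + 1) = y + b by ring, Real.Gamma_add_one hy.ne',
    Real.mul_rpow hy.le hG.le, mul_left_comm, ← Real.rpow_add hG, sub_add_cancel,
    Real.rpow_one, mul_comm] at h
  exact h

theorem Real.Gamma_mul_prod_add (x : ℝ) (n : ℕ) (hx : ∀ m : ℕ, x ≠ -m) :
    Real.Gamma x * ∏ m ∈ Finset.range n, (x + m) = Real.Gamma (x + n) := by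
  induction n with
  | zero => simp
  | succ n ih =>
    rw [Finset.prod_range_succ, ← mul_assoc, ih, Nat.cast_succ, ← add_assoc,
      Real.Gamma_add_one (fun h => hx n (by linarith)), mul_comm]

theorem tendsto_rpow_mul_risingCoeff (x : ℝ) :
    Tendsto (fun n : ℕ => (n : ℝ) ^ (1 - x) * risingCoeff x n) atTop (𝓝 (Real.Gamma x)⁻¹) := by
  -- At a pole of `Γ` the product vanishes for `n > m`, matching `Γ x = 0` and `0⁻¹ = 0`; elsewhere
  -- this is Euler's limit.
  by_cases hx : ∃ m : ℕ, x = -m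
  · obtain ⟨m, rfl⟩ := hx
    rw [Real.Gamma_neg_nat_eq_zero, inv_zero]
    refine tendsto_const_nhds.congr' ?_
    filter_upwards [eventually_gt_atTop m] with n hn
    rw [risingCoeff, Finset.prod_eq_zero (Finset.mem_range.2 hn) (by simp)]
    simp
  · push Not at hx
    have h1 := (Real.GammaSeq_tendsto_Gamma x).inv₀ (Real.Gamma_ne_zero hx)
    have h2 : Tendsto (fun n : ℕ => (n : ℝ) / (n + x)) atTop (𝓝 1) := tendsto_natCast_div_add_atTop x
    have h3 := h2.mul h1
    rw [one_mul] at h3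
    refine h3.congr' ?_
    filter_upwards [eventually_gt_atTop 0] with n hn
    have hn' : (0 : ℝ) < n := by exact_mod_cast hn
    have hxn : x + n ≠ 0 := fun h => hx n (by linarith)
    have hxn' : (n : ℝ) + x ≠ 0 := by rwa [add_comm]
    have hpow : (n : ℝ) ^ x ≠ 0 := (Real.rpow_pos_of_pos hn' x).ne'
    have hf : (n ! : ℝ) ≠ 0 := by positivity
    rw [Real.GammaSeq, risingCoeff, Finset.prod_range_succ, Real.rpow_sub hn', Real.rpow_one, inv_div]
    field_simp
    ring

/-- A bound uniform in `n`, needed for dominated convergence. Since `1 - a` may be negative, the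
reflection formula moves the estimate to `Γ a`. -/
theorem abs_rpow_mul_risingCoeff_le {a : ℝ} {n : ℕ} (ha : 0 < a) (han : a ≤ n / 2) :
    |(n : ℝ) ^ a * risingCoeff (1 - a) n| ≤ 2 ^ a * Real.Gamma a := by
  have hGa := Real.Gamma_pos_of_pos ha
  have hn : (0 : ℝ) < n := by linarith
  by_cases hx : ∃ m : ℕ, 1 - a = -m
  · obtain ⟨m, hm⟩ := hx
    have hmn : m < n := by
      have : (m : ℝ) < n := by linarith
      exact_mod_cast this
    rw [risingCoeff, Finset.prod_eq_zero (Finset.mem_range.2 hmn) (by rw [hm]; ring)]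
    simp only [zero_div, mul_zero, abs_zero]
    positivity
  · push Not at hx
    have hx' : 0 < 1 - a + n := by linarith
    have hG := Real.Gamma_pos_of_pos hx'
    have hprod := Real.Gamma_mul_prod_add (1 - a) n hx
    have hne := Real.Gamma_ne_zero hx
    have hrefl := Real.Gamma_mul_Gamma_one_sub a
    have hsin : Real.sin (Real.pi * a) ≠ 0 := by
      intro h
      rw [h, div_zero] at hrefl
      exact (mul_ne_zero hGa.ne' hne) hrefl
    have hle : |∏ m ∈ Finset.range n, (1 - a + m)| ≤ Real.Gamma a * Real.Gamma (1 - a + n) := by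
      have e : Real.pi * ∏ m ∈ Finset.range n, (1 - a + m) =
          Real.sin (Real.pi * a) * (Real.Gamma a * Real.Gamma (1 - a + n)) := by
        rw [← hprod, ← mul_assoc (Real.Gamma a), hrefl]
        field_simp
      have e' := congrArg abs e
      rw [abs_mul, abs_mul, abs_of_pos Real.pi_pos,
        abs_of_pos (mul_pos hGa hG)] at e'
      have h1 := mul_le_mul_of_nonneg_right (Real.abs_sin_le_one (Real.pi * a)) (mul_pos hGa hG).le
      have h2 := mul_le_mul_of_nonneg_right (show (1 : ℝ) ≤ Real.pi by linarith [Real.pi_gt_three])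
        (abs_nonneg (∏ m ∈ Finset.range n, (1 - a + (m : ℝ))))
      linarith
    have hratio := Real.Gamma_mul_rpow_le_Gamma_add (x := 1 - a + n) (a := a) (by linarith) ha
    rw [show 1 - a + n + a = (n : ℝ) + 1 by ring, Real.Gamma_nat_eq_factorial] at hratio
    -- The constant `2 ^ a` comes from `n ≤ 2 (n - a)`, that is, from `a ≤ n / 2`.
    have hpow : (n : ℝ) ^ a ≤ 2 ^ a * (1 - a + n - 1) ^ a := by
      rw [← Real.mul_rpow (by norm_num) (by linarith)]
      exact Real.rpow_le_rpow hn.le (by linarith) ha.le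
    have hf : (0 : ℝ) < n ! := by positivity
    rw [risingCoeff, abs_mul, abs_div, abs_of_pos hf, abs_of_pos (Real.rpow_pos_of_pos hn a),
      ← mul_div_assoc, div_le_iff₀ hf]
    calc (n : ℝ) ^ a * |∏ m ∈ Finset.range n, (1 - a + m)|
        ≤ (2 ^ a * (1 - a + n - 1) ^ a) * (Real.Gamma a * Real.Gamma (1 - a + n)) := by
          refine mul_le_mul hpow hle (abs_nonneg _) ?_
          exact mul_nonneg (by positivity) (Real.rpow_nonneg (by linarith) _)
      _ = 2 ^ a * Real.Gamma a * (Real.Gamma (1 - a + n) * (1 - a + n - 1) ^ a) := by ring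
      _ ≤ 2 ^ a * Real.Gamma a * n ! := by gcongr

/-- Ratio test: consecutive terms have ratio at most a constant times `(i + 1) ^ (β - 1)`, which
tends to `0` as `β < 1`. -/
theorem summable_pow_div_factorial_mul_Gamma {β : ℝ} (h0 : 0 < β) (h1 : β < 1) {R : ℝ}
    (hR : 0 ≤ R) :
    Summable fun i : ℕ =>
      R ^ i / (i ! : ℝ) * (2 ^ (β * (i + 1)) * Real.Gamma (β * (i + 1))) := by
  have hlim : Tendsto (fun i : ℕ => R * 2 ^ β * β ^ β * ((i : ℝ) + 1) ^ (-(1 - β))) atTop (𝓝 0) := by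
    have := ((tendsto_rpow_neg_atTop (show 0 < 1 - β by linarith)).comp
      (tendsto_atTop_add_const_right atTop (1 : ℝ) tendsto_natCast_atTop_atTop)).const_mul
      (R * 2 ^ β * β ^ β)
    simpa using this
  refine summable_of_ratio_norm_eventually_le (r := 1 / 2) (by norm_num) ?_
  filter_upwards [hlim.eventually_le_const (show (0 : ℝ) < 1 / 2 by norm_num)] with i hi
  have hi1 : (0 : ℝ) < i + 1 := by positivity
  have hy : 0 < β * ((i : ℝ) + 1) := by positivity
  have hG := Real.Gamma_pos_of_pos hy
  have hG' : 0 < Real.Gamma (β * ((i : ℝ) + 1 + 1)) := Real.Gamma_pos_of_pos (by positivity)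
  have hle := Real.Gamma_add_le_Gamma_mul_rpow hy h0 h1
  rw [show β * ((i : ℝ) + 1) + β = β * ((i : ℝ) + 1 + 1) by ring,
    Real.mul_rpow h0.le hi1.le] at hle
  push_cast
  rw [Real.norm_of_nonneg (by positivity), Real.norm_of_nonneg (by positivity)]
  calc R ^ (i + 1) / ((i + 1)! : ℝ) *
        (2 ^ (β * ((i : ℝ) + 1 + 1)) * Real.Gamma (β * ((i : ℝ) + 1 + 1)))
      ≤ R ^ (i + 1) / ((i + 1)! : ℝ) * (2 ^ (β * ((i : ℝ) + 1 + 1)) *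
        (Real.Gamma (β * ((i : ℝ) + 1)) * (β ^ β * ((i : ℝ) + 1) ^ β))) := by gcongr
    _ = (R * 2 ^ β * β ^ β * ((i : ℝ) + 1) ^ (-(1 - β))) *
        (R ^ i / (i ! : ℝ) * (2 ^ (β * ((i : ℝ) + 1)) * Real.Gamma (β * ((i : ℝ) + 1)))) := by
        rw [Nat.factorial_succ, neg_sub, Real.rpow_sub hi1, Real.rpow_one,
          show β * ((i : ℝ) + 1 + 1) = β * ((i : ℝ) + 1) + β by ring, Real.rpow_add (by norm_num)]
        push_cast
        field_simp
        ring
    _ ≤ _ := by gcongr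

theorem summable_pow_div_Gamma {β : ℝ} (h0 : 0 < β) {x : ℝ} (hx : 0 ≤ x) :
    Summable fun n : ℕ => x ^ n / Real.Gamma (β * n + 1) := by
  have hlim : Tendsto (fun n : ℕ => (β * (n : ℝ)) ^ β) atTop atTop :=
    (tendsto_rpow_atTop h0).comp (tendsto_natCast_atTop_atTop.const_mul_atTop h0)
  refine summable_of_ratio_norm_eventually_le (r := 1 / 2) (by norm_num) ?_
  filter_upwards [hlim.eventually_ge_atTop (2 * x), eventually_gt_atTop 0] with n hn hn0
  have hn' : (0 : ℝ) < n := by exact_mod_cast hn0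
  have hy : 0 < β * (n : ℝ) := by positivity
  have hG : 0 < Real.Gamma (β * n + 1) := Real.Gamma_pos_of_pos (by positivity)
  have hle := Real.Gamma_mul_rpow_le_Gamma_add (x := β * n + 1) (by linarith) h0
  rw [add_sub_cancel_right, show β * (n : ℝ) + 1 + β = β * ((n + 1 : ℕ) : ℝ) + 1 by push_cast; ring]
    at hle
  have hG' : 0 < Real.Gamma (β * ((n + 1 : ℕ) : ℝ) + 1) := Real.Gamma_pos_of_pos (by positivity)
  rw [Real.norm_of_nonneg (by positivity), Real.norm_of_nonneg (by positivity), div_le_iff₀ hG',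
    pow_succ]
  calc x ^ n * x ≤ x ^ n * (1 / 2 * (β * n) ^ β) := by gcongr; linarith
    _ = 1 / 2 * (x ^ n / Real.Gamma (β * n + 1)) * (Real.Gamma (β * n + 1) * (β * n) ^ β) := by
        field_simp
    _ ≤ _ := by gcongr

theorem tendsto_choose_div_pow {J : ℕ → ℕ} {c : ℕ → ℝ} {t : ℝ} (hc : Tendsto c atTop atTop)
    (hJ : Tendsto (fun n => (J n : ℝ) / c n) atTop (𝓝 t)) (i : ℕ) :
    Tendsto (fun n => ((J n).choose i : ℝ) / c n ^ i) atTop (𝓝 (t ^ i / i !)) := by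
  have h1 : Tendsto (fun n => (∏ m ∈ Finset.range i, ((J n : ℝ) / c n - m / c n)) / i !) atTop
      (𝓝 ((∏ _m ∈ Finset.range i, t) / i !)) := by
    refine (tendsto_finsetProd _ fun m _ => ?_).div_const _
    simpa using hJ.sub (hc.const_div_atTop (m : ℝ))
  rw [Finset.prod_const, Finset.card_range] at h1
  refine h1.congr fun n => ?_
  have h2 : ((J n).choose i : ℝ) = (∏ m ∈ Finset.range i, ((J n : ℝ) - m)) / i ! := by
    rw [← descPochhammer_eval_eq_prod_range, descPochhammer_eval_eq_descFactorial,
      Nat.descFactorial_eq_factorial_mul_choose]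
    push_cast
    field_simp
  rw [h2]
  simp_rw [← sub_div]
  rw [Finset.prod_div_distrib, Finset.prod_const, Finset.card_range]
  ring

/-! ### Local limit theorem: convergence to the M-Wright function -/

/-- The density at `τ` of the number of renewals up to time `n`, rescaled by `n ^ β`. -/
noncomputable def renewalDensity (β : ℝ) (n : ℕ) (τ : ℝ) : ℝ :=
  (n : ℝ) ^ β * renewalWeight β n ⌊τ * (n : ℝ) ^ β⌋₊

theorem renewalDensity_nonneg {β : ℝ} (h0 : 0 ≤ β) (h1 : β ≤ 1) (n : ℕ) (τ : ℝ) :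
    0 ≤ renewalDensity β n τ :=
  mul_nonneg (by positivity) (renewalWeight_nonneg h0 h1 _ _)

theorem measurable_renewalDensity (β : ℝ) (n : ℕ) : Measurable (renewalDensity β n) := by
  have : Measurable fun τ : ℝ => renewalWeight β n ⌊τ * (n : ℝ) ^ β⌋₊ :=
    (Measurable.of_discrete (f := renewalWeight β n)).comp
      (Nat.measurable_floor.comp (measurable_id.mul_const _))
  exact this.const_mul _

/-- The `i`-th term in the expansion of `renewalDensity β n τ`. -/
noncomputable def renewalDensityTerm (β : ℝ) (n : ℕ) (τ : ℝ) (i : ℕ) : ℝ :=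
  (-1) ^ i * ((⌊τ * (n : ℝ) ^ β⌋₊.choose i : ℝ) / ((n : ℝ) ^ β) ^ i) *
    ((n : ℝ) ^ (β * (i + 1)) * risingCoeff (1 - β * (i + 1)) n)

theorem renewalDensity_eq_tsum (β : ℝ) {n : ℕ} (hn : 0 < n) (τ : ℝ) :
    renewalDensity β n τ = ∑' i, renewalDensityTerm β n τ i := by
  have hn' : (0 : ℝ) < n := by exact_mod_cast hn
  rw [tsum_eq_sum (s := Finset.range (⌊τ * (n : ℝ) ^ β⌋₊ + 1)), renewalDensity,
    renewalWeight_eq_sum, Finset.mul_sum]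
  · refine Finset.sum_congr rfl fun i _ => ?_
    have hc : (0 : ℝ) < (n : ℝ) ^ β := Real.rpow_pos_of_pos hn' β
    rw [renewalDensityTerm, Real.rpow_mul hn'.le, Real.rpow_add hc, Real.rpow_natCast,
      Real.rpow_one]
    field_simp
  · intro i hi
    rw [Finset.mem_range, not_lt, Nat.add_one_le_iff] at hi
    rw [renewalDensityTerm, Nat.choose_eq_zero_of_lt hi]
    simp

theorem tendsto_natCast_rpow_atTop {β : ℝ} (h0 : 0 < β) :
    Tendsto (fun n : ℕ => (n : ℝ) ^ β) atTop atTop :=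
  (tendsto_rpow_atTop h0).comp tendsto_natCast_atTop_atTop

theorem tendsto_floor_mul_rpow_div {β : ℝ} (h0 : 0 < β) {τ : ℝ} (hτ : 0 ≤ τ) :
    Tendsto (fun n : ℕ => (⌊τ * (n : ℝ) ^ β⌋₊ : ℝ) / (n : ℝ) ^ β) atTop (𝓝 τ) :=
  (tendsto_nat_floor_mul_div_atTop hτ).comp (tendsto_natCast_rpow_atTop h0)

theorem tendsto_renewalDensityTerm {β : ℝ} (h0 : 0 < β) {τ : ℝ} (hτ : 0 ≤ τ) (i : ℕ) :
    Tendsto (fun n => renewalDensityTerm β n τ i) atTop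
      (𝓝 ((-τ) ^ i / (i ! : ℝ) * (Real.Gamma (-β * i + (1 - β)))⁻¹)) := by
  have h1 := tendsto_choose_div_pow (tendsto_natCast_rpow_atTop h0)
    (tendsto_floor_mul_rpow_div h0 hτ) i
  have h2 := tendsto_rpow_mul_risingCoeff (1 - β * (i + 1))
  rw [sub_sub_cancel] at h2
  have h3 := (h1.const_mul ((-1) ^ i)).mul h2
  rw [show -β * (i : ℝ) + (1 - β) = 1 - β * (i + 1) by ring, neg_pow τ, mul_div_assoc]
  exact h3

/-- Nonzero terms have `i ≤ R n ^ β`, hence `β (i + 1) ≤ n / 2` for large `n` because `β < 1`; this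
is the range of `abs_rpow_mul_risingCoeff_le`. -/
theorem eventually_norm_renewalDensityTerm_le {β : ℝ} (h0 : 0 < β) (h1 : β < 1) {R : ℝ}
    (hR : 0 ≤ R) : ∀ᶠ n : ℕ in atTop, ∀ τ ∈ Set.Icc 0 R, ∀ i,
      ‖renewalDensityTerm β n τ i‖ ≤
        R ^ i / (i ! : ℝ) * (2 ^ (β * (i + 1)) * Real.Gamma (β * (i + 1))) := by
  have hlim : Tendsto (fun n : ℕ => β * (R * (n : ℝ) ^ (-(1 - β)) + 1 / n)) atTop (𝓝 0) := by
    have := ((((tendsto_rpow_neg_atTop (show 0 < 1 - β by linarith)).comp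
      tendsto_natCast_atTop_atTop).const_mul R).add
      tendsto_one_div_atTop_nhds_zero_nat).const_mul β
    simpa using this
  filter_upwards [hlim.eventually_le_const (show (0 : ℝ) < 1 / 2 by norm_num),
    eventually_gt_atTop 0] with n hn hn0 τ hτ i
  have hn' : (0 : ℝ) < n := by exact_mod_cast hn0
  have hc : (0 : ℝ) < (n : ℝ) ^ β := Real.rpow_pos_of_pos hn' β
  have hG : 0 < Real.Gamma (β * ((i : ℝ) + 1)) := Real.Gamma_pos_of_pos (by positivity)
  have hj : (⌊τ * (n : ℝ) ^ β⌋₊ : ℝ) ≤ R * (n : ℝ) ^ β :=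
    (Nat.floor_le (mul_nonneg hτ.1 hc.le)).trans (by gcongr; exact hτ.2)
  rcases lt_or_ge ⌊τ * (n : ℝ) ^ β⌋₊ i with hi | hi
  · rw [renewalDensityTerm, Nat.choose_eq_zero_of_lt hi]
    simp only [Nat.cast_zero, zero_div, mul_zero, zero_mul, norm_zero]
    positivity
  · have hi' : (i : ℝ) ≤ R * (n : ℝ) ^ β := le_trans (by exact_mod_cast hi) hj
    have ha : β * ((i : ℝ) + 1) ≤ n / 2 := by
      have e : (n : ℝ) ^ (-(1 - β)) = (n : ℝ) ^ β / n := by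
        rw [neg_sub, Real.rpow_sub hn', Real.rpow_one]
      rw [e] at hn
      calc β * ((i : ℝ) + 1) ≤ β * (R * (n : ℝ) ^ β + 1) := by gcongr
        _ = n * (β * (R * ((n : ℝ) ^ β / n) + 1 / n)) := by field_simp
        _ ≤ n * (1 / 2) := by gcongr
        _ = n / 2 := by ring
    have hb := abs_rpow_mul_risingCoeff_le (show 0 < β * ((i : ℝ) + 1) by positivity) ha
    rw [renewalDensityTerm, norm_mul, norm_mul, norm_pow, norm_neg, norm_one, one_pow, one_mul]
    refine mul_le_mul ?_ hb (norm_nonneg _) (by positivity)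
    rw [Real.norm_of_nonneg (by positivity), div_le_iff₀ (by positivity)]
    calc ((⌊τ * (n : ℝ) ^ β⌋₊.choose i : ℕ) : ℝ)
        ≤ (⌊τ * (n : ℝ) ^ β⌋₊ : ℝ) ^ i / i ! := Nat.choose_le_pow_div i _
      _ ≤ (R * (n : ℝ) ^ β) ^ i / i ! := by gcongr
      _ = R ^ i / i ! * ((n : ℝ) ^ β) ^ i := by ring

theorem tendsto_renewalDensity {β : ℝ} (h0 : 0 < β) (h1 : β < 1) {τ : ℝ} (hτ : 0 ≤ τ) :
    Tendsto (fun n => renewalDensity β n τ) atTop (𝓝 (mWright β τ)) := by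
  have h := tendsto_tsum_of_dominated_convergence
    (summable_pow_div_factorial_mul_Gamma h0 h1 hτ)
    (tendsto_renewalDensityTerm h0 hτ)
    ((eventually_norm_renewalDensityTerm_le h0 h1 hτ).mono fun n hn i => hn τ ⟨hτ, le_rfl⟩ i)
  refine h.congr' ?_
  filter_upwards [eventually_gt_atTop 0] with n hn
  rw [renewalDensity_eq_tsum β hn]

theorem exists_eventually_renewalDensity_le {β : ℝ} (h0 : 0 < β) (h1 : β < 1) {R : ℝ}
    (hR : 0 ≤ R) :
    ∃ C, 0 ≤ C ∧ ∀ᶠ n : ℕ in atTop, ∀ τ ∈ Set.Icc 0 R, renewalDensity β n τ ≤ C := by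
  have hs := summable_pow_div_factorial_mul_Gamma h0 h1 hR
  refine ⟨∑' i : ℕ, R ^ i / (i ! : ℝ) * (2 ^ (β * (i + 1)) * Real.Gamma (β * (i + 1))),
    tsum_nonneg fun i => ?_, ?_⟩
  · have : 0 < Real.Gamma (β * ((i : ℝ) + 1)) := Real.Gamma_pos_of_pos (by positivity)
    positivity
  · filter_upwards [eventually_norm_renewalDensityTerm_le h0 h1 hR, eventually_gt_atTop 0]
      with n hn hn0 τ hτ
    rw [renewalDensity_eq_tsum β hn0]
    exact (le_abs_self _).trans (tsum_of_norm_bounded hs.hasSum (hn τ hτ))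

theorem mWright_nonneg {β : ℝ} (h0 : 0 < β) (h1 : β < 1) {τ : ℝ} (hτ : 0 ≤ τ) :
    0 ≤ mWright β τ :=
  ge_of_tendsto' (tendsto_renewalDensity h0 h1 hτ) fun n => renewalDensity_nonneg h0.le h1.le n τ

theorem aemeasurable_mWright {β : ℝ} (h0 : 0 < β) (h1 : β < 1) :
    AEMeasurable (mWright β) (volume.restrict (Set.Ici (0 : ℝ))) :=
  aemeasurable_of_tendsto_metrizable_ae atTop
    (fun n => (measurable_renewalDensity β n).aemeasurable)
    ((ae_restrict_iff' measurableSet_Ici).2 (ae_of_all _ fun _ hτ => tendsto_renewalDensity h0 h1 hτ))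

/-! ### Moments of the M-Wright function -/

theorem lintegral_Ici_floor_mul {c : ℝ} (hc : 0 < c) (F : ℕ → ℝ≥0∞) :
    ∫⁻ τ in Set.Ici (0 : ℝ), F ⌊τ * c⌋₊ = ∑' j, F j * ENNReal.ofReal (1 / c) := by
  have hm : Measurable fun τ : ℝ => ⌊τ * c⌋₊ := Nat.measurable_floor.comp (measurable_id.mul_const _)
  rw [← lintegral_map (f := F) (g := fun τ : ℝ => ⌊τ * c⌋₊) Measurable.of_discrete hm,
    lintegral_countable']
  refine tsum_congr fun j => ?_
  rw [Measure.map_apply hm (measurableSet_singleton j),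
    Measure.restrict_apply (hm (measurableSet_singleton j))]
  have : (fun τ : ℝ => ⌊τ * c⌋₊) ⁻¹' {j} ∩ Set.Ici 0 = Set.Ico (j / c) ((j + 1) / c) := by
    ext τ
    simp only [Set.mem_inter_iff, Set.mem_preimage, Set.mem_singleton_iff, Set.mem_Ici, Set.mem_Ico,
      div_le_iff₀ hc, lt_div_iff₀ hc]
    constructor
    · rintro ⟨h, h0⟩
      exact (Nat.floor_eq_iff (mul_nonneg h0 hc.le)).1 h
    · rintro ⟨h, h'⟩
      have hτ : 0 ≤ τ * c := le_trans (Nat.cast_nonneg j) h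
      exact ⟨(Nat.floor_eq_iff hτ).2 ⟨h, h'⟩, nonneg_of_mul_nonneg_left hτ hc⟩
  rw [this, Real.volume_Ico]
  congr 3
  ring

/-- The rescaled rising factorial of the number of renewals, which approximates `τ ^ k`. -/
noncomputable def renewalFactor (β : ℝ) (n k : ℕ) (τ : ℝ) : ℝ :=
  (k ! : ℝ) * (((⌊τ * (n : ℝ) ^ β⌋₊ + k).choose k : ℝ) / ((n : ℝ) ^ β) ^ k)

theorem renewalFactor_nonneg (β : ℝ) (n k : ℕ) (τ : ℝ) : 0 ≤ renewalFactor β n k τ := by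
  unfold renewalFactor; positivity

theorem measurable_renewalFactor (β : ℝ) (n k : ℕ) : Measurable (renewalFactor β n k) := by
  have : Measurable fun τ : ℝ => (((⌊τ * (n : ℝ) ^ β⌋₊ + k).choose k : ℕ) : ℝ) :=
    (Measurable.of_discrete (f := fun j : ℕ => (((j + k).choose k : ℕ) : ℝ))).comp
      (Nat.measurable_floor.comp (measurable_id.mul_const _))
  exact (this.div_const _).const_mul _

theorem tendsto_renewalFactor {β : ℝ} (h0 : 0 < β) (k : ℕ) {τ : ℝ} (hτ : 0 ≤ τ) :
    Tendsto (fun n => renewalFactor β n k τ) atTop (𝓝 (τ ^ k)) := by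
  have hJ : Tendsto (fun n : ℕ => ((⌊τ * (n : ℝ) ^ β⌋₊ + k : ℕ) : ℝ) / (n : ℝ) ^ β) atTop (𝓝 τ) := by
    have := (tendsto_floor_mul_rpow_div h0 hτ).add
      ((tendsto_natCast_rpow_atTop h0).const_div_atTop (k : ℝ))
    rw [add_zero] at this
    refine this.congr fun n => ?_
    push_cast
    ring
  have h := (tendsto_choose_div_pow (tendsto_natCast_rpow_atTop h0) hJ k).const_mul (k ! : ℝ)
  rwa [mul_div_cancel₀ _ (by positivity)] at h

theorem mul_renewalFactor_le {β : ℝ} {n : ℕ} (hn : 0 < n) (k : ℕ) {τ : ℝ} :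
    τ * renewalFactor β n k τ ≤ renewalFactor β n (k + 1) τ := by
  have hc : (0 : ℝ) < (n : ℝ) ^ β := Real.rpow_pos_of_pos (by exact_mod_cast hn) β
  have hτ : τ ≤ ((⌊τ * (n : ℝ) ^ β⌋₊ + k + 1 : ℕ) : ℝ) / (n : ℝ) ^ β := by
    rw [le_div_iff₀ hc]
    push_cast
    linarith [Nat.lt_floor_add_one (τ * (n : ℝ) ^ β), k.cast_nonneg (α := ℝ)]
  refine (mul_le_mul_of_nonneg_right hτ (renewalFactor_nonneg β n k τ)).trans_eq ?_
  have h := Nat.add_one_mul_choose_eq (⌊τ * (n : ℝ) ^ β⌋₊ + k) k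
  have h' : ((⌊τ * (n : ℝ) ^ β⌋₊ + k + 1 : ℕ) : ℝ) * ((⌊τ * (n : ℝ) ^ β⌋₊ + k).choose k : ℝ) =
      ((⌊τ * (n : ℝ) ^ β⌋₊ + k + 1).choose (k + 1) : ℝ) * ((k + 1 : ℕ) : ℝ) := by exact_mod_cast h
  rw [renewalFactor, renewalFactor, Nat.factorial_succ, ← add_assoc, pow_succ]
  push_cast at h' ⊢
  field_simp
  linear_combination h'

theorem renewalFactor_le {β : ℝ} (h0 : 0 ≤ β) {n : ℕ} (hn : 0 < n) (k : ℕ) {τ R : ℝ}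
    (hτ : τ ∈ Set.Icc 0 R) : renewalFactor β n k τ ≤ (R + k) ^ k := by
  have hc : (1 : ℝ) ≤ (n : ℝ) ^ β := Real.one_le_rpow (by exact_mod_cast hn) h0
  have hR : 0 ≤ R := hτ.1.trans hτ.2
  have h1 : ((⌊τ * (n : ℝ) ^ β⌋₊ + k : ℕ) : ℝ) ≤ (R + k) * (n : ℝ) ^ β := by
    push_cast
    have h2 : (⌊τ * (n : ℝ) ^ β⌋₊ : ℝ) ≤ R * (n : ℝ) ^ β :=
      (Nat.floor_le (mul_nonneg hτ.1 (by positivity))).trans (by gcongr; exact hτ.2)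
    nlinarith [k.cast_nonneg (α := ℝ)]
  calc renewalFactor β n k τ
      ≤ (k ! : ℝ) * (((⌊τ * (n : ℝ) ^ β⌋₊ + k : ℕ) : ℝ) ^ k / k ! / ((n : ℝ) ^ β) ^ k) := by
        unfold renewalFactor
        gcongr
        exact Nat.choose_le_pow_div k _
    _ ≤ (k ! : ℝ) * (((R + k) * (n : ℝ) ^ β) ^ k / k ! / ((n : ℝ) ^ β) ^ k) := by gcongr
    _ = (R + k) ^ k := by
        rw [mul_pow]
        field_simp

/-- The integrand is constant on intervals of length `n ^ (-β)`, which cancels the factor `n ^ β` of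
the density and leaves the rising factorial moment. -/
theorem lintegral_renewalFactor_mul_renewalDensity {β : ℝ} (h0 : 0 ≤ β) (h1 : β ≤ 1) {n : ℕ}
    (hn : 0 < n) (k : ℕ) :
    ∫⁻ τ in Set.Ici (0 : ℝ), ENNReal.ofReal (renewalFactor β n k τ * renewalDensity β n τ) =
      ENNReal.ofReal ((k ! : ℝ) * ((n : ℝ) ^ (-(β * k)) * risingCoeff (β * k + 1) n)) := by
  have hn' : (0 : ℝ) < n := by exact_mod_cast hn
  have hc : (0 : ℝ) < (n : ℝ) ^ β := Real.rpow_pos_of_pos hn' β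
  refine (lintegral_Ici_floor_mul hc fun j => ENNReal.ofReal
    ((k ! : ℝ) * (((j + k).choose k : ℝ) / ((n : ℝ) ^ β) ^ k) *
      ((n : ℝ) ^ β * renewalWeight β n j))).trans ?_
  rw [tsum_eq_sum (s := Finset.range (n + 1)), ← sum_choose_mul_renewalWeight, Finset.mul_sum,
    Finset.mul_sum, ENNReal.ofReal_sum_of_nonneg]
  · refine Finset.sum_congr rfl fun j _ => ?_
    rw [← ENNReal.ofReal_mul' (by positivity), Real.rpow_neg hn'.le, Real.rpow_mul hn'.le,
      Real.rpow_natCast]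
    congr 1
    field_simp
  · intro j _
    have := renewalWeight_nonneg h0 h1 n j
    positivity
  · intro j hj
    rw [Finset.mem_range, not_lt, Nat.add_one_le_iff] at hj
    rw [renewalWeight_eq_zero hj]
    simp

theorem tendsto_lintegral_renewalFactor_mul_renewalDensity {β : ℝ} (h0 : 0 ≤ β) (h1 : β ≤ 1)
    (k : ℕ) :
    Tendsto (fun n : ℕ => ∫⁻ τ in Set.Ici (0 : ℝ),
      ENNReal.ofReal (renewalFactor β n k τ * renewalDensity β n τ)) atTop
      (𝓝 (ENNReal.ofReal ((k ! : ℝ) / Real.Gamma (β * k + 1)))) := by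
  have h := (tendsto_rpow_mul_risingCoeff (β * k + 1)).const_mul (k ! : ℝ)
  rw [show 1 - (β * (k : ℝ) + 1) = -(β * k) by ring, ← div_eq_mul_inv] at h
  refine (ENNReal.tendsto_ofReal h).congr' ?_
  filter_upwards [eventually_gt_atTop 0] with n hn
  rw [lintegral_renewalFactor_mul_renewalDensity h0 h1 hn]

theorem tendsto_renewalFactor_mul_renewalDensity {β : ℝ} (h0 : 0 < β) (h1 : β < 1) (k : ℕ) {τ : ℝ}
    (hτ : 0 ≤ τ) :
    Tendsto (fun n => ENNReal.ofReal (renewalFactor β n k τ * renewalDensity β n τ)) atTop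
      (𝓝 (ENNReal.ofReal (τ ^ k * mWright β τ))) :=
  ENNReal.tendsto_ofReal ((tendsto_renewalFactor h0 k hτ).mul (tendsto_renewalDensity h0 h1 hτ))

theorem measurable_renewalFactor_mul_renewalDensity (β : ℝ) (n k : ℕ) :
    Measurable fun τ => ENNReal.ofReal (renewalFactor β n k τ * renewalDensity β n τ) :=
  ((measurable_renewalFactor β n k).mul (measurable_renewalDensity β n)).ennreal_ofReal

theorem tendsto_setLIntegral_Icc_renewal {β : ℝ} (h0 : 0 < β) (h1 : β < 1) (k : ℕ) {R : ℝ}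
    (hR : 0 ≤ R) :
    Tendsto (fun n : ℕ => ∫⁻ τ in Set.Icc 0 R,
      ENNReal.ofReal (renewalFactor β n k τ * renewalDensity β n τ)) atTop
      (𝓝 (∫⁻ τ in Set.Icc 0 R, ENNReal.ofReal (τ ^ k * mWright β τ))) := by
  obtain ⟨C, hC0, hC⟩ := exists_eventually_renewalDensity_le h0 h1 hR
  refine tendsto_lintegral_filter_of_dominated_convergence
    (fun _ => ENNReal.ofReal ((R + k) ^ k * C))
    (Eventually.of_forall fun n => measurable_renewalFactor_mul_renewalDensity β n k) ?_ ?_ ?_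
  · filter_upwards [hC, eventually_gt_atTop 0] with n hn hn0
    refine (ae_restrict_iff' measurableSet_Icc).2 (ae_of_all _ fun τ hτ => ?_)
    exact ENNReal.ofReal_le_ofReal (mul_le_mul (renewalFactor_le h0.le hn0 k hτ) (hn τ hτ)
      (renewalDensity_nonneg h0.le h1.le n τ) (by positivity))
  · rw [lintegral_const, Measure.restrict_apply_univ, Real.volume_Icc]
    exact ENNReal.mul_ne_top ENNReal.ofReal_ne_top ENNReal.ofReal_ne_top
  · exact (ae_restrict_iff' measurableSet_Icc).2 (ae_of_all _ fun τ hτ =>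
      tendsto_renewalFactor_mul_renewalDensity h0 h1 k hτ.1)

/-- Markov's inequality: beyond `R` the factor of order `k` is at most `R⁻¹` times that of order `k
+ 1`. -/
theorem lintegral_renewal_le_add_tail {β : ℝ} (h0 : 0 ≤ β) (h1 : β ≤ 1) {n : ℕ} (hn : 0 < n)
    (k : ℕ) {R : ℝ} (hR : 0 < R) :
    ∫⁻ τ in Set.Ici (0 : ℝ), ENNReal.ofReal (renewalFactor β n k τ * renewalDensity β n τ) ≤
      (∫⁻ τ in Set.Icc 0 R, ENNReal.ofReal (renewalFactor β n k τ * renewalDensity β n τ)) +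
      ENNReal.ofReal R⁻¹ * ∫⁻ τ in Set.Ici (0 : ℝ),
        ENNReal.ofReal (renewalFactor β n (k + 1) τ * renewalDensity β n τ) := by
  have hunion : Set.Ici (0 : ℝ) = Set.Icc 0 R ∪ Set.Ioi R := (Set.Icc_union_Ioi_eq_Ici hR.le).symm
  calc _ ≤ (∫⁻ τ in Set.Icc 0 R, ENNReal.ofReal (renewalFactor β n k τ * renewalDensity β n τ)) +
        ∫⁻ τ in Set.Ioi R, ENNReal.ofReal (renewalFactor β n k τ * renewalDensity β n τ) := by
        rw [hunion]; exact lintegral_union_le _ _ _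
    _ ≤ _ := by
        gcongr
        rw [← lintegral_const_mul _ (measurable_renewalFactor_mul_renewalDensity β n (k + 1))]
        refine (setLIntegral_mono' measurableSet_Ioi fun τ hτ => ?_).trans
          (lintegral_mono_set fun τ hτ => hR.le.trans (le_of_lt hτ))
        rw [← ENNReal.ofReal_mul (by positivity), ← mul_assoc]
        refine ENNReal.ofReal_le_ofReal
          (mul_le_mul_of_nonneg_right ?_ (renewalDensity_nonneg h0 h1 n τ))
        rw [← div_eq_inv_mul, le_div_iff₀ hR, mul_comm]
        exact (mul_le_mul_of_nonneg_right (le_of_lt hτ) (renewalFactor_nonneg β n k τ)).trans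
          (mul_renewalFactor_le hn k)

/-- Fatou's lemma gives `≤`. For `≥`, pass to the limit on `[0, R]`, bound the tail by `R⁻¹` times
the next moment, and let `R → ∞`. -/
theorem lintegral_pow_mul_mWright {β : ℝ} (h0 : 0 < β) (h1 : β < 1) (k : ℕ) :
    ∫⁻ τ in Set.Ici (0 : ℝ), ENNReal.ofReal (τ ^ k * mWright β τ) =
      ENNReal.ofReal ((k ! : ℝ) / Real.Gamma (β * k + 1)) := by
  refine le_antisymm ?_ ?_
  · refine le_trans (le_of_eq ?_) ((lintegral_liminf_le fun n =>
      measurable_renewalFactor_mul_renewalDensity β n k).trans_eq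
      (tendsto_lintegral_renewalFactor_mul_renewalDensity h0.le h1.le k).liminf_eq)
    exact setLIntegral_congr_fun measurableSet_Ici fun τ hτ =>
      (tendsto_renewalFactor_mul_renewalDensity h0 h1 k hτ).liminf_eq.symm
  · have key : ∀ R : ℝ, 0 < R → ENNReal.ofReal ((k ! : ℝ) / Real.Gamma (β * k + 1)) ≤
        (∫⁻ τ in Set.Ici (0 : ℝ), ENNReal.ofReal (τ ^ k * mWright β τ)) +
        ENNReal.ofReal R⁻¹ *
          ENNReal.ofReal (((k + 1)! : ℝ) / Real.Gamma (β * (k + 1 : ℕ) + 1)) := by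
      intro R hR
      refine le_trans (le_of_tendsto_of_tendsto
        (tendsto_lintegral_renewalFactor_mul_renewalDensity h0.le h1.le k)
        ((tendsto_setLIntegral_Icc_renewal h0 h1 k hR.le).add (ENNReal.Tendsto.const_mul
          (tendsto_lintegral_renewalFactor_mul_renewalDensity h0.le h1.le (k + 1))
          (Or.inr (ENNReal.ofReal_ne_top (r := R⁻¹))))) ?_) ?_
      · filter_upwards [eventually_gt_atTop 0] with n hn
        exact lintegral_renewal_le_add_tail h0.le h1.le hn k hR
      · gcongr
        exact fun τ hτ => hτ.1
    have hlim : Tendsto (fun R : ℝ =>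
        (∫⁻ τ in Set.Ici (0 : ℝ), ENNReal.ofReal (τ ^ k * mWright β τ)) +
        ENNReal.ofReal R⁻¹ *
          ENNReal.ofReal (((k + 1)! : ℝ) / Real.Gamma (β * (k + 1 : ℕ) + 1))) atTop
        (𝓝 (∫⁻ τ in Set.Ici (0 : ℝ), ENNReal.ofReal (τ ^ k * mWright β τ))) := by
      have h := (ENNReal.Tendsto.mul_const
        (ENNReal.tendsto_ofReal tendsto_inv_atTop_zero)
        (b := ENNReal.ofReal (((k + 1)! : ℝ) / Real.Gamma (β * (k + 1 : ℕ) + 1)))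
        (Or.inr ENNReal.ofReal_ne_top)).const_add
        (∫⁻ τ in Set.Ici (0 : ℝ), ENNReal.ofReal (τ ^ k * mWright β τ))
      simpa using h
    exact ge_of_tendsto hlim ((eventually_gt_atTop 0).mono key)

/-! ### From moments to the Laplace transform and the Poisson mixture -/

section Moments

variable {β : ℝ} {ν : Measure ℝ}

theorem isProbabilityMeasure_of_moments
    (hmom : ∀ k : ℕ, ∫⁻ τ, ENNReal.ofReal (τ ^ k) ∂ν =
      ENNReal.ofReal ((k ! : ℝ) / Real.Gamma (β * k + 1))) :
    IsProbabilityMeasure ν := ⟨by simpa using hmom 0⟩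

theorem integrable_pow_of_moments (hpos : ∀ᵐ τ ∂ν, 0 ≤ τ)
    (hmom : ∀ k : ℕ, ∫⁻ τ, ENNReal.ofReal (τ ^ k) ∂ν =
      ENNReal.ofReal ((k ! : ℝ) / Real.Gamma (β * k + 1))) (k : ℕ) :
    Integrable (fun τ : ℝ => τ ^ k) ν :=
  (lintegral_ofReal_ne_top_iff_integrable (by fun_prop)
    (hpos.mono fun τ hτ => pow_nonneg hτ k)).1 (by rw [hmom]; exact ENNReal.ofReal_ne_top)

theorem integral_pow_of_moments (h0 : 0 < β) (hpos : ∀ᵐ τ ∂ν, 0 ≤ τ)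
    (hmom : ∀ k : ℕ, ∫⁻ τ, ENNReal.ofReal (τ ^ k) ∂ν =
      ENNReal.ofReal ((k ! : ℝ) / Real.Gamma (β * k + 1))) (k : ℕ) :
    ∫ τ, τ ^ k ∂ν = (k ! : ℝ) / Real.Gamma (β * k + 1) := by
  have hG : 0 < Real.Gamma (β * k + 1) := Real.Gamma_pos_of_pos (by positivity)
  rw [integral_eq_lintegral_of_nonneg_ae (hpos.mono fun τ hτ => pow_nonneg hτ k) (by fun_prop),
    hmom, ENNReal.toReal_ofReal (by positivity)]

theorem integrable_exp_mul_of_moments (h0 : 0 < β) (hpos : ∀ᵐ τ ∂ν, 0 ≤ τ)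
    (hmom : ∀ k : ℕ, ∫⁻ τ, ENNReal.ofReal (τ ^ k) ∂ν =
      ENNReal.ofReal ((k ! : ℝ) / Real.Gamma (β * k + 1))) (x : ℝ) :
    Integrable (fun τ : ℝ => Real.exp (x * τ)) ν := by
  -- With `|x|` the exponential series has non-negative terms, so sum and integral commute without
  -- prior integrability.
  have hint : Integrable (fun τ : ℝ => Real.exp (|x| * τ)) ν := by
    refine (lintegral_ofReal_ne_top_iff_integrable (by fun_prop)
      (ae_of_all _ fun τ => (Real.exp_pos _).le)).1 ?_
    have h : ∫⁻ τ, ENNReal.ofReal (Real.exp (|x| * τ)) ∂ν =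
        ∑' k : ℕ, ENNReal.ofReal (|x| ^ k / Real.Gamma (β * k + 1)) := by
      calc _ = ∫⁻ τ, ∑' k : ℕ, ENNReal.ofReal (|x| ^ k / k !) * ENNReal.ofReal (τ ^ k) ∂ν := by
            refine lintegral_congr_ae (hpos.mono fun τ hτ => ?_)
            have hs := NormedSpace.expSeries_div_hasSum_exp (|x| * τ)
            rw [← Real.exp_eq_exp_ℝ] at hs
            change ENNReal.ofReal (Real.exp (|x| * τ)) = _
            rw [← hs.tsum_eq, ENNReal.ofReal_tsum_of_nonneg (fun k => by positivity) hs.summable]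
            refine tsum_congr fun k => ?_
            rw [← ENNReal.ofReal_mul (by positivity), mul_pow]
            congr 1
            ring
        _ = _ := by
            rw [lintegral_tsum fun k => by fun_prop]
            refine tsum_congr fun k => ?_
            rw [lintegral_const_mul _ (by fun_prop), hmom, ← ENNReal.ofReal_mul (by positivity)]
            congr 1
            field_simp
    rw [h]
    exact (summable_pow_div_Gamma h0 (abs_nonneg x)).tsum_ofReal_ne_top
  refine hint.mono' (by fun_prop) (hpos.mono fun τ hτ => ?_)
  rw [Real.norm_of_nonneg (Real.exp_pos _).le]
  exact Real.exp_le_exp.2 (mul_le_mul_of_nonneg_right (le_abs_self x) hτ)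

theorem integrable_cexp_mul_of_moments (h0 : 0 < β) (hpos : ∀ᵐ τ ∂ν, 0 ≤ τ)
    (hmom : ∀ k : ℕ, ∫⁻ τ, ENNReal.ofReal (τ ^ k) ∂ν =
      ENNReal.ofReal ((k ! : ℝ) / Real.Gamma (β * k + 1))) (z : ℂ) :
    Integrable (fun τ : ℝ => Complex.exp (z * (τ : ℂ))) ν :=
  (integrable_exp_mul_of_moments h0 hpos hmom z.re).mono' (by fun_prop)
    (ae_of_all _ fun τ => by rw [Complex.norm_exp, Complex.re_mul_ofReal])

theorem integral_cexp_mul_of_moments (h0 : 0 < β) (hpos : ∀ᵐ τ ∂ν, 0 ≤ τ)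
    (hmom : ∀ k : ℕ, ∫⁻ τ, ENNReal.ofReal (τ ^ k) ∂ν =
      ENNReal.ofReal ((k ! : ℝ) / Real.Gamma (β * k + 1))) (z : ℂ) :
    ∫ τ : ℝ, Complex.exp (z * (τ : ℂ)) ∂ν = mittagLeffler β z := by
  have hint : ∀ k : ℕ, Integrable (fun τ : ℝ => z ^ k / (k ! : ℂ) * ((τ ^ k : ℝ) : ℂ)) ν := fun k =>
    ((integrable_pow_of_moments hpos hmom k).ofReal).const_mul _
  have hnorm : ∀ k : ℕ, ∫ τ : ℝ, ‖z ^ k / (k ! : ℂ) * ((τ ^ k : ℝ) : ℂ)‖ ∂ν =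
      ‖z‖ ^ k / Real.Gamma (β * k + 1) := by
    intro k
    have : ∀ᵐ τ : ℝ ∂ν, ‖z ^ k / (k ! : ℂ) * ((τ ^ k : ℝ) : ℂ)‖ = ‖z‖ ^ k / k ! * τ ^ k :=
      hpos.mono fun τ hτ => by
        rw [norm_mul, norm_div, norm_pow, Complex.norm_natCast, Complex.norm_real,
          Real.norm_of_nonneg (pow_nonneg hτ k)]
    rw [integral_congr_ae this, integral_const_mul, integral_pow_of_moments h0 hpos hmom]
    field_simp
  have h := hasSum_integral_of_summable_integral_norm hint
    (by simpa only [hnorm] using summable_pow_div_Gamma h0 (norm_nonneg z))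
  have hsum : ∀ τ : ℝ, ∑' k : ℕ, z ^ k / (k ! : ℂ) * ((τ ^ k : ℝ) : ℂ) = Complex.exp (z * τ) := by
    intro τ
    rw [Complex.exp_eq_exp_ℂ, ← (NormedSpace.expSeries_div_hasSum_exp (z * (τ : ℂ))).tsum_eq]
    refine tsum_congr fun k => ?_
    push_cast
    ring
  simp only [hsum] at h
  rw [← h.tsum_eq, mittagLeffler]
  refine tsum_congr fun k => ?_
  have hf : (k ! : ℂ) ≠ 0 := by exact_mod_cast k.factorial_ne_zero
  rw [integral_const_mul, integral_complex_ofReal, integral_pow_of_moments h0 hpos hmom]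
  push_cast
  field_simp

/-- `E_β` is the complex moment generating function of `ν`, and exponential integrability on all of
`ℝ` gives its derivatives at `-lam` as integrals of `τ ^ k * exp (-lam * τ)`. -/
theorem fractionalPoissonWeight_eq_integral_of_moments (h0 : 0 < β) (hpos : ∀ᵐ τ ∂ν, 0 ≤ τ)
    (hmom : ∀ k : ℕ, ∫⁻ τ, ENNReal.ofReal (τ ^ k) ∂ν =
      ENNReal.ofReal ((k ! : ℝ) / Real.Gamma (β * k + 1))) (lam : ℝ) (k : ℕ) :
    Integrable (fun τ : ℝ => Real.exp (-(lam * τ)) * (lam * τ) ^ k / k !) ν ∧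
    fractionalPoissonWeight lam β k = ∫ τ : ℝ, Real.exp (-(lam * τ)) * (lam * τ) ^ k / (k !) ∂ν := by
  have hset : integrableExpSet id ν = Set.univ := Set.eq_univ_of_forall fun x =>
    integrable_exp_mul_of_moments h0 hpos hmom x
  have hmgf : mittagLeffler β = complexMGF id ν := funext fun z =>
    (integral_cexp_mul_of_moments h0 hpos hmom z).symm
  have hform : ∀ τ : ℝ, Real.exp (-(lam * τ)) * (lam * τ) ^ k / k ! =
      lam ^ k / k ! * (τ ^ k * Real.exp (-lam * τ)) := fun τ => by
    rw [mul_pow, neg_mul]; ring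
  have hint : Integrable (fun τ : ℝ => τ ^ k * Real.exp (-lam * τ)) ν :=
    integrable_pow_mul_exp_of_mem_interior_integrableExpSet (X := id) (by simp [hset]) k
  simp only [hform]
  refine ⟨hint.const_mul _, ?_⟩
  rw [fractionalPoissonWeight, hmgf, iteratedDeriv_complexMGF (by simp [hset]), integral_const_mul]
  congr 1
  rw [← Complex.ofReal_re (∫ τ : ℝ, τ ^ k * Real.exp (-lam * τ) ∂ν), ← integral_complex_ofReal]
  simp

theorem measurable_poissonMeasure : Measurable poissonMeasure := by
  refine Measure.measurable_of_measurable_coe _ fun s hs => ?_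
  have : ∀ r : ℝ≥0, poissonMeasure r s =
      ∑' k : ℕ, ENNReal.ofReal (Real.exp (-r) * r ^ k / k !) * (Measure.dirac k s) := fun r => by
    rw [poissonMeasure, Measure.sum_apply _ hs]
    rfl
  simp only [this]
  fun_prop

theorem fractionalPoissonWeight_nonneg_of_moments (h0 : 0 < β) (hpos : ∀ᵐ τ ∂ν, 0 ≤ τ)
    (hmom : ∀ k : ℕ, ∫⁻ τ, ENNReal.ofReal (τ ^ k) ∂ν =
      ENNReal.ofReal ((k ! : ℝ) / Real.Gamma (β * k + 1))) {lam : ℝ} (hlam : 0 ≤ lam) (k : ℕ) :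
    0 ≤ fractionalPoissonWeight lam β k := by
  rw [(fractionalPoissonWeight_eq_integral_of_moments h0 hpos hmom lam k).2]
  exact integral_nonneg_of_ae (hpos.mono fun τ hτ => by simp only [Pi.zero_apply]; positivity)

theorem fractionalPoissonMeasure_eq_bind_of_moments (h0 : 0 < β) (hpos : ∀ᵐ τ ∂ν, 0 ≤ τ)
    (hmom : ∀ k : ℕ, ∫⁻ τ, ENNReal.ofReal (τ ^ k) ∂ν =
      ENNReal.ofReal ((k ! : ℝ) / Real.Gamma (β * k + 1))) {lam : ℝ} (hlam : 0 ≤ lam) :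
    fractionalPoissonMeasure lam β =
      ν.bind fun τ : ℝ => poissonMeasure (Real.toNNReal (lam * τ)) := by
  have hmeas : Measurable fun τ : ℝ => poissonMeasure (Real.toNNReal (lam * τ)) :=
    measurable_poissonMeasure.comp (by fun_prop)
  refine Measure.ext_of_singleton fun k => ?_
  obtain ⟨hint, hw⟩ := fractionalPoissonWeight_eq_integral_of_moments h0 hpos hmom lam k
  rw [fractionalPoissonMeasure, Measure.sum_smul_dirac_singleton,
    Measure.bind_apply (measurableSet_singleton k) hmeas.aemeasurable, hw,
    ofReal_integral_eq_lintegral_ofReal hint (hpos.mono fun τ hτ => by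
      simp only [Pi.zero_apply]; positivity)]
  refine lintegral_congr_ae (hpos.mono fun τ hτ => ?_)
  simp only
  rw [poissonMeasure_singleton, Real.coe_toNNReal _ (by positivity)]

end Moments

/-! ### The measure `ν_β` and the conclusion -/

theorem ae_nonneg_mWrightMeasure (β : ℝ) : ∀ᵐ τ ∂(mWrightMeasure β), 0 ≤ τ := by
  unfold mWrightMeasure
  split_ifs
  · simp [ae_dirac_eq]
  · exact (withDensity_absolutelyContinuous _ _).ae_le (ae_restrict_mem measurableSet_Ici)

theorem lintegral_pow_mWrightMeasure {β : ℝ} (h0 : 0 < β) (h1 : β ≤ 1) (k : ℕ) :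
    ∫⁻ τ, ENNReal.ofReal (τ ^ k) ∂(mWrightMeasure β) =
      ENNReal.ofReal ((k ! : ℝ) / Real.Gamma (β * k + 1)) := by
  rcases h1.eq_or_lt with rfl | h1
  -- For `β = 1` every prescribed moment is `k! / Γ(k + 1) = 1`, as for the Dirac measure at `1`.
  · have : (k ! : ℝ) ≠ 0 := by positivity
    rw [mWrightMeasure, if_pos rfl, lintegral_dirac, one_mul, Real.Gamma_nat_eq_factorial,
      div_self this, one_pow]
  · rw [mWrightMeasure, if_neg h1.ne, lintegral_withDensity_eq_lintegral_mul₀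
      (aemeasurable_mWright h0 h1).ennreal_ofReal (by fun_prop), ← lintegral_pow_mul_mWright h0 h1]
    refine setLIntegral_congr_fun measurableSet_Ici fun τ hτ => ?_
    rw [Pi.mul_apply, mul_comm, ENNReal.ofReal_mul (pow_nonneg hτ k)]

theorem mainTheorem12 (β : ℝ) (hβ0 : 0 < β) (hβ1 : β ≤ 1) :
    (β < 1 → ∀ τ : ℝ, 0 ≤ τ → 0 ≤ mWright β τ) ∧
    IsProbabilityMeasure (mWrightMeasure β) ∧
    (∀ z : ℂ, Integrable (fun τ : ℝ => Complex.exp (-z * (τ : ℂ))) (mWrightMeasure β) ∧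
      ∫ τ : ℝ, Complex.exp (-z * (τ : ℂ)) ∂(mWrightMeasure β) = mittagLeffler β (-z)) ∧
    ∀ lam : ℝ, 0 < lam →
      (∀ k : ℕ, 0 ≤ fractionalPoissonWeight lam β k) ∧
      fractionalPoissonMeasure lam β =
        (mWrightMeasure β).bind fun τ : ℝ => poissonMeasure (Real.toNNReal (lam * τ)) := by
  have hpos := ae_nonneg_mWrightMeasure β
  have hmom := lintegral_pow_mWrightMeasure hβ0 hβ1
  exact ⟨fun h1 _ hτ => mWright_nonneg hβ0 h1 hτ, isProbabilityMeasure_of_moments hmom,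
    fun z => ⟨integrable_cexp_mul_of_moments hβ0 hpos hmom (-z),
      integral_cexp_mul_of_moments hβ0 hpos hmom (-z)⟩,
    fun lam hlam => ⟨fractionalPoissonWeight_nonneg_of_moments hβ0 hpos hmom hlam.le,
      fractionalPoissonMeasure_eq_bind_of_moments hβ0 hpos hmom hlam.le⟩⟩
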